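/- **Theorem (lower bound for $Q(A)$).** There exist absolute constants $0<c_2<1<c_3$ such that the following holds for every integer $n\ge 3$ and every real $m\ge (1/c_2)^{n-1}$. Let $A=\{a_1,\dots,a_M\}\subset\mathbb{S}^{n-1}$, where $M$ is a Poisson random variable with $\mathbb{E}[M]=m$ and, independently of $M$, the points $a_1,a_2,\dots$ are independent and uniformly distributed on the Euclidean unit sphere $\mathbb{S}^{n-1}\subset\mathbb{R}^n$. Let $Q(A)=\operatorname{conv}(A)$, and let $\operatorname{diam}(Q(A))$ be its combinatorial diameter: the maximum over pairs of vertices of $Q(A)$ of the minimum number of edges of $Q(A)$ in a path along edges joining the two vertices (and $0$ if $Q(A)$ is empty). Then, with probability at least $1-\exp\!\left(-c_3^{\,n-1}\,m^{1/(n-1)}\right)$, $$\operatorname{diam}(Q(A))\;\ge\; c_2\, m^{1/(n-1)} .$$ -/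

import Mathlib

open MeasureTheory ProbabilityTheory
open scoped ENNReal NNReal

noncomputable section

namespace RandomPolytope

/-- The unit sphere `S^{n-1}` of `ℝⁿ`, with the Euclidean norm. -/
abbrev UnitSphere (n : ℕ) : Type := Metric.sphere (0 : EuclideanSpace ℝ (Fin n)) 1

/-- The uniform probability distribution on `S^{n-1}` (for `n ≥ 1`): the surface measure,
normalised to have total mass one. -/
def uniformSphere (n : ℕ) : Measure (UnitSphere n) :=
  ((volume : Measure (EuclideanSpace ℝ (Fin n))).toSphere Set.univ)⁻¹ •
    (volume : Measure (EuclideanSpace ℝ (Fin n))).toSphere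

/-- The graph of a polytope `P`: its nodes are the vertices (extreme points) of `P`, and two
distinct vertices are adjacent when the segment joining them is an edge, that is, a face of `P`
(the set of maximisers over `P` of a linear functional). -/
def polytopeGraph {E : Type*} [NormedAddCommGroup E] [NormedSpace ℝ E] (P : Set E) :
    SimpleGraph (P.extremePoints ℝ) where
  Adj v w := v ≠ w ∧ IsExposed ℝ P (segment ℝ (v : E) (w : E))
  symm := ⟨fun v w h => ⟨h.1.symm, by rw [segment_symm]; exact h.2⟩⟩
  loopless := ⟨fun _ h => h.1 rfl⟩

/-- The combinatorial diameter of a polytope `P`: the largest distance between two vertices, where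
the distance of two vertices is the least number of edges in an edge path joining them. It is
`0` for the empty polytope and for a point. -/
def combDiam {E : Type*} [NormedAddCommGroup E] [NormedSpace ℝ E] (P : Set E) : ℕ∞ :=
  (polytopeGraph P).ediam

/-- `Q(A)` for the list of points `A = {a₁, …, a_M}` on the sphere, namely the convex hull of the
first `M` members of the sequence `a`. -/
def hullOfFirst {n : ℕ} (M : ℕ) (a : ℕ → UnitSphere n) : Set (EuclideanSpace ℝ (Fin n)) :=
  convexHull ℝ ((fun i => (a i : EuclideanSpace ℝ (Fin n))) '' {i | i < M})

/-- The random data `M, a₁, a₂, …` on the probability space `(Ω, μ)`: `M` is Poisson with mean `m`,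
the `aᵢ` are independent and uniform on `S^{n-1}`, and `M` is independent of the sequence `a`. The
set `A = {a₁, …, a_M}` is then a homogeneous Poisson point process on `S^{n-1}`. -/
structure IsPoissonSample {Ω : Type*} [MeasurableSpace Ω] (μ : Measure Ω) (n : ℕ) (m : ℝ≥0)
    (M : Ω → ℕ) (a : ℕ → Ω → UnitSphere n) : Prop where
  poisson : HasLaw M (poissonMeasure m) μ
  uniform : ∀ i, HasLaw (a i) (uniformSphere n) μ
  indep : iIndepFun a μ
  indep_count : IndepFun M (fun ω i => a i ω) μ

end RandomPolytope

end

/-! Put `k = m ^ (1 / (n - 1))`, the reciprocal of the typical spacing of the sample, and fix a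
maximal `ε`-separated net on the sphere with `ε` a large constant times `1 / k`. The balls of radius
`ε / 2` about the net points are disjoint cells, and a given cell is empty with very small
probability.

An edge of the polytope lies in a supporting hyperplane, which cuts off a cap with no sample point
in its interior. Going from one end of the edge to the pole of the cap and down to the other end,
along great circles, one meets only empty cells except near the two ends (`walkWithin_near_of_cap`).
A path with few edges therefore becomes a walk in the net with few nonempty cells
(`walkWithin_of_walk`). If its ends are far apart, the walk visits at least about `1 / (16 * ε)`, a
constant multiple of `k`, different net points, almost all with empty cells
(`exists_path_of_combDiam_lt`).

Such a walk is unlikely, by a union bound (`IsPoissonSample.measure_exists_path_le`). The number of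
paths with `L` points, and of choices of the empty cells on them, is exponential in `n * L`, up to
the choice of a starting point. A given choice has probability exponentially small in `L * (2 ^ 20)
^ (n - 1)`, which wins for every `n ≥ 3`. Two distant vertices exist unless one of two opposite caps
of fixed radius contains no sample point. -/

namespace RandomPolytope

open Metric Set

/-! ### Volume bounds for separated sets, and maximal separated nets. -/

section Packing

/-- A finite `ε`-separated set in a ball of radius `R` has at most `(1 + 2 R / ε) ^ dim` points. -/
theorem card_le_of_pairwise_le_dist {E : Type*} [NormedAddCommGroup E] [NormedSpace ℝ E]
    [FiniteDimensional ℝ E] (s : Finset E) (x : E) {ε R : ℝ} (hε : 0 < ε) (hR : 0 ≤ R)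
    (hsep : (s : Set E).Pairwise fun p q => ε ≤ dist p q) (hs : ∀ p ∈ s, dist p x ≤ R) :
    (s.card : ℝ) ≤ (1 + 2 * R / ε) ^ Module.finrank ℝ E := by
  borelize E
  let μ : Measure E := Measure.addHaar
  have hdisj : Set.Pairwise (s : Set E) (Function.onFun Disjoint fun c => ball (c : E) (ε / 2)) := by
    intro c hc d hd hcd
    apply ball_disjoint_ball
    linarith [hsep hc hd hcd]
  have hsub : (⋃ c ∈ s, ball (c : E) (ε / 2)) ⊆ ball x (R + ε / 2) := by
    refine iUnion₂_subset fun c hc => ball_subset_ball' ?_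
    linarith [hs c hc]
  have hvol : (s.card : ℝ≥0∞) * ENNReal.ofReal ((ε / 2) ^ Module.finrank ℝ E) * μ (ball 0 1) ≤
      ENNReal.ofReal ((R + ε / 2) ^ Module.finrank ℝ E) * μ (ball 0 1) := by
    have h1 := measure_mono (μ := μ) hsub
    rw [measure_biUnion_finset hdisj fun c _ => measurableSet_ball,
      μ.addHaar_ball_of_pos _ (by positivity)] at h1
    simp only [μ.addHaar_ball_of_pos _ (half_pos hε), Finset.sum_const, nsmul_eq_mul] at h1
    rwa [mul_assoc]
  have hcard := (ENNReal.mul_le_mul_iff_left (measure_ball_pos _ _ zero_lt_one).ne'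
    measure_ball_lt_top.ne).1 hvol
  have hreal := ENNReal.toReal_le_of_le_ofReal (by positivity) hcard
  rw [ENNReal.toReal_mul, ENNReal.toReal_natCast, ENNReal.toReal_ofReal (by positivity)] at hreal
  rw [show 1 + 2 * R / ε = (R + ε / 2) / (ε / 2) by field_simp; ring, div_pow,
    le_div_iff₀ (by positivity)]
  exact hreal

theorem card_le_of_pairwise_le_dist_sphere {n : ℕ} (s : Finset (UnitSphere n))
    (x : EuclideanSpace ℝ (Fin n)) {ε R : ℝ} (hε : 0 < ε) (hR : 0 ≤ R)
    (hsep : (s : Set (UnitSphere n)).Pairwise fun p q => ε ≤ dist p q)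
    (hs : ∀ p ∈ s, dist (p : EuclideanSpace ℝ (Fin n)) x ≤ R) :
    (s.card : ℝ) ≤ (1 + 2 * R / ε) ^ n := by
  have h := card_le_of_pairwise_le_dist (s.map ⟨_, Subtype.val_injective⟩) x hε hR
    (by
      intro p hp q hq hpq
      simp only [Finset.coe_map, Function.Embedding.coeFn_mk, Set.mem_image] at hp hq
      obtain ⟨p, hp, rfl⟩ := hp
      obtain ⟨q, hq, rfl⟩ := hq
      exact hsep hp hq (fun h => hpq (by rw [h])))
    (by
      intro p hp
      simp only [Finset.mem_map, Function.Embedding.coeFn_mk] at hp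
      obtain ⟨p, hp, rfl⟩ := hp
      exact hs p hp)
  simpa using h

/-- In a compact space there are finite `ε`-separated sets that are also `ε`-dense. -/
theorem exists_finset_separated_dense (X : Type*) [MetricSpace X] [CompactSpace X] {ε : ℝ}
    (hε : 0 < ε) :
    ∃ N : Finset X, ((N : Set X).Pairwise fun p q => ε ≤ dist p q) ∧
      ∀ x, ∃ q ∈ N, dist x q ≤ ε := by
  obtain ⟨S, -, hS⟩ := zorn_subset_nonempty {S : Set X | S.Pairwise fun p q => ε ≤ dist p q}
    (by
      intro c hc hchain _
      refine ⟨⋃₀ c, ?_, fun s hs => subset_sUnion_of_mem hs⟩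
      exact (pairwise_sUnion hchain.directedOn).2 hc) ∅ (by simp)
  have hfin : S.Finite := by
    obtain ⟨t, -, ht, hcov⟩ := finite_approx_of_totallyBounded
      (isCompact_univ (X := X)).totallyBounded (ε / 2) (half_pos hε)
    have hch : ∀ x : X, ∃ y ∈ t, dist x y < ε / 2 := fun x => by
      simpa using hcov (mem_univ x)
    choose f hf hfd using hch
    refine Set.Finite.of_finite_image (f := f) (ht.subset (by rintro _ ⟨x, -, rfl⟩; exact hf x)) ?_
    intro x hx y hy hxy
    by_contra hne
    have h1 := hS.prop hx hy hne
    have h2 := dist_triangle_right x y (f x)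
    have h3 := hfd x
    have h4 := hfd y
    rw [← hxy] at h4
    linarith
  refine ⟨hfin.toFinset, by simpa using hS.prop, fun x => ?_⟩
  by_contra! hx
  simp only [Finite.mem_toFinset] at hx
  have hins : (insert x S).Pairwise fun p q => ε ≤ dist p q := by
    refine hS.prop.insert fun y hy _ => ⟨(hx y hy).le, ?_⟩
    rw [dist_comm]
    exact (hx y hy).le
  have := hx x (hS.le_of_ge hins (subset_insert x S) (mem_insert x S))
  rw [dist_self] at this
  linarith

end Packing

/-! ### Lower bound for the uniform measure of a spherical ball. -/

section SphereMeasure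

open scoped Pointwise

/-- The open cone over a spherical ball contains a ball about each of its axis points. -/
theorem ball_smul_subset_cone {n : ℕ} (q : UnitSphere n) {ρ t : ℝ} (hρ : 0 < ρ) (hρ1 : ρ ≤ 1)
    (ht : 1 / 4 ≤ t) (ht' : t ≤ 1 / 2) :
    ball (t • (q : EuclideanSpace ℝ (Fin n))) (ρ / 16) ⊆
      Ioo (0 : ℝ) 1 • (Subtype.val '' ball q ρ) := by
  intro y hy
  rw [mem_ball, dist_eq_norm] at hy
  have hq : ‖(q : EuclideanSpace ℝ (Fin n))‖ = 1 := by simp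
  have htq : ‖t • (q : EuclideanSpace ℝ (Fin n))‖ = t := by
    rw [norm_smul, hq, mul_one, Real.norm_of_nonneg (by linarith)]
  have hnorm : |‖y‖ - t| < ρ / 16 := by
    have := abs_norm_sub_norm_le y (t • (q : EuclideanSpace ℝ (Fin n)))
    rw [htq] at this
    linarith
  obtain ⟨hl, hu⟩ := abs_lt.1 hnorm
  have hy0 : 0 < ‖y‖ := by linarith
  have hmem : ‖y‖⁻¹ • y ∈ sphere (0 : EuclideanSpace ℝ (Fin n)) 1 := by
    simp [norm_smul, hy0.ne']
  refine ⟨‖y‖, ⟨hy0, by linarith⟩, ‖y‖⁻¹ • y, ⟨⟨_, hmem⟩, ?_, rfl⟩, by simp [smul_smul, hy0.ne']⟩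
  rw [mem_ball, Subtype.dist_eq, dist_eq_norm]
  have key : ‖y‖ • (‖y‖⁻¹ • y - (q : EuclideanSpace ℝ (Fin n))) =
      (y - t • (q : EuclideanSpace ℝ (Fin n))) + (t - ‖y‖) • (q : EuclideanSpace ℝ (Fin n)) := by
    rw [smul_sub, smul_smul, mul_inv_cancel₀ hy0.ne', one_smul, sub_smul]
    abel
  have h1 : ‖y‖ * ‖‖y‖⁻¹ • y - (q : EuclideanSpace ℝ (Fin n))‖ < ρ / 8 := by
    calc ‖y‖ * ‖‖y‖⁻¹ • y - (q : EuclideanSpace ℝ (Fin n))‖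
        = ‖‖y‖ • (‖y‖⁻¹ • y - (q : EuclideanSpace ℝ (Fin n)))‖ := by
          rw [norm_smul, norm_norm]
      _ ≤ ‖y - t • (q : EuclideanSpace ℝ (Fin n))‖ +
          ‖(t - ‖y‖) • (q : EuclideanSpace ℝ (Fin n))‖ := by rw [key]; exact norm_add_le _ _
      _ < ρ / 16 + ρ / 16 := by
          rw [norm_smul, hq, mul_one, Real.norm_eq_abs, abs_sub_comm]
          exact add_lt_add hy hnorm
      _ = ρ / 8 := by ring
  -- Since `t ≥ 1 / 4` and `ρ ≤ 1`, the norm of `y` is at least `3 / 16`, so dividing by it leaves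
  -- an error below `2 * ρ / 3`.
  by_contra! hge
  have h2 : (3 / 16) * ρ ≤ ‖y‖ * ‖‖y‖⁻¹ • y - (q : EuclideanSpace ℝ (Fin n))‖ := by
    gcongr
    linarith
  linarith

theorem uniformSphere_eq {n : ℕ} (hn : n ≠ 0) {S : Set (UnitSphere n)} (hS : MeasurableSet S) :
    uniformSphere n S = volume (Ioo (0 : ℝ) 1 • (Subtype.val '' S)) /
      volume (ball (0 : EuclideanSpace ℝ (Fin n)) 1) := by
  rw [uniformSphere, Measure.smul_apply, Measure.toSphere_apply' _ hS, Measure.toSphere_apply_univ,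
    finrank_euclideanSpace_fin, smul_eq_mul, mul_comm, ← div_eq_mul_inv]
  exact ENNReal.mul_div_mul_left _ _ (by exact_mod_cast hn) (ENNReal.natCast_ne_top n)

/-- Spherical balls of radius `ρ` have uniform measure at least of the order `ρ ^ (n - 1)`. -/
theorem ofReal_le_uniformSphere_ball {n : ℕ} (hn : n ≠ 0) (q : UnitSphere n) {ρ : ℝ} (hρ : 0 < ρ)
    (hρ1 : ρ ≤ 1) :
    ENNReal.ofReal ((1 / 16) ^ n * ρ ^ (n - 1)) ≤ uniformSphere n (ball q ρ) := by
  have hball0 := measure_ball_pos (volume : Measure (EuclideanSpace ℝ (Fin n))) 0 one_pos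
  have hballt : volume (ball (0 : EuclideanSpace ℝ (Fin n)) 1) ≠ ⊤ := measure_ball_lt_top.ne
  rw [uniformSphere_eq hn measurableSet_ball, ENNReal.le_div_iff_mul_le (Or.inl hball0.ne')
    (Or.inl hballt)]
  -- A single ball in the cone would only give order `ρ ^ n`. Stacking about `1 / ρ` disjoint balls
  -- along the axis gains the missing factor.
  set K : ℕ := ⌈1 / ρ⌉₊ with hK
  let c : ℕ → EuclideanSpace ℝ (Fin n) := fun j => (1 / 4 + j * (ρ / 8) : ℝ) • (q : _)
  have hsub : (⋃ j ∈ Finset.range K, ball (c j) (ρ / 16)) ⊆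
      Ioo (0 : ℝ) 1 • (Subtype.val '' ball q ρ) := by
    refine iUnion₂_subset fun j hj => ball_smul_subset_cone q hρ hρ1 ?_ ?_
    · have : 0 ≤ (j : ℝ) * (ρ / 8) := by positivity
      linarith
    · have hj1 : (j : ℝ) < 1 / ρ := Nat.lt_ceil.1 (Finset.mem_range.1 hj)
      have : (j : ℝ) * ρ < 1 := by rwa [lt_div_iff₀ hρ] at hj1
      linarith
  have hdisj : Set.Pairwise (Finset.range K : Set ℕ)
      (Function.onFun Disjoint fun j => ball (c j) (ρ / 16)) := by
    intro i _ j _ hij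
    apply ball_disjoint_ball
    have hq : ‖(q : EuclideanSpace ℝ (Fin n))‖ = 1 := by simp
    have h1 : (1 : ℝ) ≤ |(i : ℝ) - j| := by
      have : (1 : ℤ) ≤ |(i : ℤ) - j| := Int.one_le_abs (sub_ne_zero.2 (by exact_mod_cast hij))
      exact_mod_cast this
    have h2 : dist (c i) (c j) = |(i : ℝ) - j| * (ρ / 8) := by
      simp only [c]
      rw [dist_eq_norm, ← sub_smul, norm_smul, hq, mul_one, Real.norm_eq_abs,
        ← abs_of_pos (show 0 < ρ / 8 by positivity), ← abs_mul, abs_of_pos (show 0 < ρ / 8 by positivity)]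
      congr 1
      ring
    rw [h2]
    nlinarith
  have hvol := measure_mono (μ := volume) hsub
  rw [measure_biUnion_finset hdisj fun c _ => measurableSet_ball] at hvol
  simp only [Measure.addHaar_ball_of_pos _ _ (show 0 < ρ / 16 by positivity), Finset.sum_const,
    Finset.card_range, nsmul_eq_mul, finrank_euclideanSpace_fin] at hvol
  refine le_trans ?_ hvol
  rw [← mul_assoc, ← ENNReal.ofReal_natCast, ← ENNReal.ofReal_mul (by positivity)]
  refine mul_le_mul_left (ENNReal.ofReal_le_ofReal ?_) _
  calc (1 / 16) ^ n * ρ ^ (n - 1) = 1 / ρ * (ρ / 16) ^ n := by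
        rw [div_eq_mul_one_div ρ 16, mul_pow, ← mul_pow_sub_one hn ρ]
        field_simp
    _ ≤ K * (ρ / 16) ^ n := by
        gcongr
        exact Nat.le_ceil _

end SphereMeasure

/-! ### Void probabilities of the Poisson sample. -/

section Poisson

/-- The probability that a Poisson sample on the sphere misses a given measurable set. -/
theorem IsPoissonSample.measure_forall_notMem_le {Ω : Type*} [MeasurableSpace Ω] {μ : Measure Ω}
    [IsProbabilityMeasure μ] {n : ℕ} {m : ℝ≥0} {M : Ω → ℕ} {a : ℕ → Ω → UnitSphere n}
    (h : IsPoissonSample μ n m M a) {T : Set (UnitSphere n)} (hT : MeasurableSet T) {s : ℝ}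
    (hs : ENNReal.ofReal s ≤ uniformSphere n T) :
    μ {ω | ∀ i < M ω, a i ω ∉ T} ≤ ENNReal.ofReal (Real.exp (-(m * s))) := by
  have hprob : IsProbabilityMeasure (uniformSphere n) := by
    rw [← (h.uniform 0).map_eq]
    exact Measure.isProbabilityMeasure_map (h.uniform 0).aemeasurable
  set p : ℝ := (uniformSphere n).real Tᶜ with hp
  have hp0 : 0 ≤ p := measureReal_nonneg
  have hp1 : p ≤ 1 - s := by
    rw [hp, probReal_compl_eq_one_sub hT]
    have : s ≤ (uniformSphere n).real T :=
      (ENNReal.ofReal_le_iff_le_toReal (measure_ne_top _ _)).1 hs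
    linarith
  have hmiss : ∀ j : ℕ, μ (⋂ i ∈ Finset.range j, a i ⁻¹' Tᶜ) = ENNReal.ofReal (p ^ j) := by
    intro j
    rw [h.indep.meas_biInter (fun i _ => ⟨Tᶜ, hT.compl, rfl⟩)]
    have : ∀ i, μ (a i ⁻¹' Tᶜ) = ENNReal.ofReal p := by
      intro i
      rw [hp, ofReal_measureReal]
      exact (h.uniform i).measure_eq (p := fun x => x ∈ Tᶜ) hT.compl
    rw [Finset.prod_congr rfl fun i _ => this i]
    simp [ENNReal.ofReal_pow hp0]
  have hjoint : ∀ j : ℕ, μ ({ω | M ω = j} ∩ ⋂ i ∈ Finset.range j, a i ⁻¹' Tᶜ) =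
      ENNReal.ofReal (Real.exp (-m) * m ^ j / (j).factorial * p ^ j) := by
    intro j
    have hset : (⋂ i ∈ Finset.range j, a i ⁻¹' Tᶜ) = (fun ω i => a i ω) ⁻¹'
        (⋂ i ∈ Finset.range j, (fun f : ℕ → UnitSphere n => f i) ⁻¹' Tᶜ) := by
      ext; simp
    have hmeas : MeasurableSet
        (⋂ i ∈ Finset.range j, (fun f : ℕ → UnitSphere n => f i) ⁻¹' Tᶜ) :=
      Finset.measurableSet_biInter _ fun i _ => measurable_pi_apply i hT.compl
    have h1 := h.indep_count.measure_inter_preimage_eq_mul {j} _ (measurableSet_singleton j) hmeas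
    rw [← hset, hmiss] at h1
    have h2 : μ (M ⁻¹' {j}) = ENNReal.ofReal (Real.exp (-m) * m ^ j / (j).factorial) := by
      rw [← poissonMeasure_singleton]
      exact h.poisson.measure_eq (p := fun x => x ∈ ({j} : Set ℕ)) (measurableSet_singleton j)
    rw [h2, ← ENNReal.ofReal_mul (by positivity)] at h1
    exact h1
  have hsum : HasSum (fun j : ℕ => Real.exp (-m) * m ^ j / (j).factorial * p ^ j)
      (Real.exp (-m) * Real.exp (m * p)) := by
    have := (NormedSpace.expSeries_div_hasSum_exp ((m : ℝ) * p)).mul_left (Real.exp (-m))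
    rw [← Real.exp_eq_exp_ℝ] at this
    refine this.congr_fun fun j => ?_
    rw [mul_pow]
    ring
  -- Splitting by the value of `M`, the Poisson weights sum `p ^ j` to `exp (-m * (1 - p))`. Only a
  -- countable union bound is used, so the event itself need not be measurable.
  calc μ {ω | ∀ i < M ω, a i ω ∉ T}
      ≤ μ (⋃ j : ℕ, {ω | M ω = j} ∩ ⋂ i ∈ Finset.range j, a i ⁻¹' Tᶜ) := by
        refine measure_mono fun ω hω => mem_iUnion.2 ⟨M ω, rfl, ?_⟩
        simpa using hω
    _ ≤ ∑' j : ℕ, μ ({ω | M ω = j} ∩ ⋂ i ∈ Finset.range j, a i ⁻¹' Tᶜ) := measure_iUnion_le _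
    _ = ENNReal.ofReal (Real.exp (-m) * Real.exp (m * p)) := by
        simp_rw [hjoint]
        rw [← ENNReal.ofReal_tsum_of_nonneg (fun j => by positivity) hsum.summable, hsum.tsum_eq]
    _ ≤ ENNReal.ofReal (Real.exp (-(m * s))) := by
        rw [← Real.exp_add]
        gcongr
        nlinarith [m.coe_nonneg]

end Poisson

end RandomPolytope

namespace RandomPolytope

open Metric Set InnerProductGeometry

/-! ### Walks confined to a set of vertices, and the proximity graph of a net. -/

section Walks

variable {V : Type*} {G : SimpleGraph V} {S T : Set V} {p q r : V}

/-- The vertices `p` and `q` are joined by a walk all of whose vertices lie in `S`. -/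
def WalkWithin (G : SimpleGraph V) (S : Set V) (p q : V) : Prop :=
  ∃ w : G.Walk p q, ∀ x ∈ w.support, x ∈ S

theorem WalkWithin.refl (hp : p ∈ S) : WalkWithin G S p p :=
  ⟨.nil, by simpa using hp⟩

theorem WalkWithin.trans (h : WalkWithin G S p q) (h' : WalkWithin G S q r) :
    WalkWithin G S p r := by
  obtain ⟨w, hw⟩ := h
  obtain ⟨w', hw'⟩ := h'
  refine ⟨w.append w', fun x hx => ?_⟩
  rcases (SimpleGraph.Walk.mem_support_append_iff _ _).1 hx with hx | hx
  exacts [hw x hx, hw' x hx]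

theorem WalkWithin.symm (h : WalkWithin G S p q) : WalkWithin G S q p := by
  obtain ⟨w, hw⟩ := h
  exact ⟨w.reverse, fun x hx => hw x (by simpa using hx)⟩

theorem WalkWithin.mono (h : WalkWithin G S p q) (hST : S ⊆ T) : WalkWithin G T p q := by
  obtain ⟨w, hw⟩ := h
  exact ⟨w, fun x hx => hST (hw x hx)⟩

/-- The graph on the points of `N` in which distinct points at distance at most `r` are adjacent. -/
def netGraph {X : Type*} [PseudoMetricSpace X] (N : Finset X) (r : ℝ) : SimpleGraph X where
  Adj p q := p ≠ q ∧ p ∈ N ∧ q ∈ N ∧ dist p q ≤ r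
  symm := ⟨fun p q h => ⟨h.1.symm, h.2.2.1, h.2.1, by rw [dist_comm]; exact h.2.2.2⟩⟩
  loopless := ⟨fun _ h => h.1 rfl⟩

theorem WalkWithin.of_dist_le {X : Type*} [PseudoMetricSpace X] {N : Finset X} {r : ℝ} {S : Set X}
    {p q : X} (hpN : p ∈ N) (hqN : q ∈ N) (hpS : p ∈ S) (hqS : q ∈ S) (h : dist p q ≤ r) :
    WalkWithin (netGraph N r) S p q := by
  by_cases hpq : p = q
  · subst hpq
    exact .refl hpS
  · have hadj : (netGraph N r).Adj p q := ⟨hpq, hpN, hqN, h⟩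
    exact ⟨hadj.toWalk, by simp [SimpleGraph.Adj.toWalk, hpS, hqS]⟩

theorem dist_le_length_mul {X : Type*} [PseudoMetricSpace X] {N : Finset X} {r : ℝ} {p q : X}
    (w : (netGraph N r).Walk p q) : dist p q ≤ w.length * r := by
  induction w with
  | nil => simp
  | cons h w ih =>
    rw [SimpleGraph.Walk.length_cons]
    push_cast
    linarith [dist_triangle _ _ _ |>.trans (add_le_add h.2.2.2 ih)]

end Walks

/-! ### Great circle arcs, angles and chords. -/

section Arcs

variable {E : Type*} [NormedAddCommGroup E] [InnerProductSpace ℝ E]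

theorem cos_angle_of_norm_one {u a : E} (hu : ‖u‖ = 1) (ha : ‖a‖ = 1) :
    Real.cos (angle u a) = inner ℝ u a := by
  have := cos_angle_mul_norm_mul_norm u a
  simpa [hu, ha] using this

/-- The great circle arc through `u` and `a`, parametrised by the angle with `u`. -/
theorem exists_arc {u a : E} (hu : ‖u‖ = 1) (ha : ‖a‖ = 1) (hsin : 0 < Real.sin (angle u a)) :
    ∃ c : ℝ → E, c 0 = u ∧ c (angle u a) = a ∧ (∀ t, ‖c t‖ = 1) ∧
      (∀ s t, dist (c s) (c t) ≤ |s - t|) ∧ ∀ t, 0 ≤ t → t ≤ Real.pi → angle u (c t) = t := by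
  have hcos := cos_angle_of_norm_one hu ha
  set α := angle u a with hα
  have huu : inner ℝ u u = 1 := by rw [real_inner_self_eq_norm_sq, hu]; norm_num
  have haa : inner ℝ a a = 1 := by rw [real_inner_self_eq_norm_sq, ha]; norm_num
  have hsc := Real.sin_sq_add_cos_sq α
  -- Gram–Schmidt: `u` and `b` are orthonormal, and the arc is `cos t • u + sin t • b`.
  set b : E := (Real.sin α)⁻¹ • (a - Real.cos α • u) with hb
  have hub : inner ℝ u b = 0 := by
    rw [hb, inner_smul_right, inner_sub_right, inner_smul_right, huu, ← hcos]
    ring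
  have hbu : inner ℝ b u = 0 := by rw [real_inner_comm, hub]
  have hbb : inner ℝ b b = 1 := by
    rw [hb, inner_smul_right, inner_smul_left, inner_sub_left, inner_sub_right, inner_sub_right,
      inner_smul_left, inner_smul_right, inner_smul_left, inner_smul_right, huu, haa,
      real_inner_comm u a, ← hcos]
    simp only [conj_trivial]
    field_simp
    linear_combination -hsc
  have hip : ∀ x y z w : ℝ, inner ℝ (x • u + y • b) (z • u + w • b) = x * z + y * w := by
    intro x y z w
    simp only [inner_add_left, inner_add_right, inner_smul_left, inner_smul_right, huu, hub, hbu,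
      hbb, conj_trivial]
    ring
  have hnorm : ∀ t, ‖Real.cos t • u + Real.sin t • b‖ = 1 := by
    intro t
    have h1 : ‖Real.cos t • u + Real.sin t • b‖ ^ 2 = 1 := by
      rw [← real_inner_self_eq_norm_sq, hip]
      linear_combination Real.sin_sq_add_cos_sq t
    exact (pow_eq_one_iff_of_nonneg (norm_nonneg _) two_ne_zero).1 h1
  refine ⟨fun t => Real.cos t • u + Real.sin t • b, by simp, ?_, hnorm, ?_, ?_⟩
  · simp only [hb]
    rw [smul_inv_smul₀ hsin.ne']
    abel
  · intro s t
    refine abs_le_of_sq_le_sq' ?_ (abs_nonneg _) |>.2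
    have hd : (Real.cos s • u + Real.sin s • b) - (Real.cos t • u + Real.sin t • b) =
        (Real.cos s - Real.cos t) • u + (Real.sin s - Real.sin t) • b := by
      rw [sub_smul, sub_smul]
      abel
    rw [dist_eq_norm, hd, ← real_inner_self_eq_norm_sq, hip, sq_abs]
    -- The squared chord is `2 - 2 * cos (s - t)`, which is at most `(s - t) ^ 2`.
    have h1 := Real.one_sub_sq_div_two_le_cos (x := s - t)
    rw [Real.cos_sub] at h1
    nlinarith [Real.sin_sq_add_cos_sq s, Real.sin_sq_add_cos_sq t]
  · intro t h0 h1
    rw [angle, hu, hnorm, inner_add_right, inner_smul_right, inner_smul_right, huu, hub]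
    simp [Real.arccos_cos h0 h1]

theorem angle_le_angle_of_inner_le {u a x : E} (hu : ‖u‖ = 1) (ha : ‖a‖ = 1) (hx : ‖x‖ = 1)
    (h : inner ℝ u x ≤ inner ℝ u a) : angle u a ≤ angle u x := by
  rw [angle, angle, hu, ha, hx]
  exact Real.arccos_le_arccos (by simpa using h)

/-- The chord of two unit vectors is at least `2 / π` times their angle. -/
theorem two_div_pi_mul_angle_le_dist {x y : E} (hx : ‖x‖ = 1) (hy : ‖y‖ = 1) :
    2 / Real.pi * angle x y ≤ dist x y := by
  have h0 := angle_nonneg x y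
  have h1 := angle_le_pi x y
  have hcos := cos_angle_of_norm_one hx hy
  have hsin := Real.mul_le_sin (x := angle x y / 2) (by linarith) (by linarith)
  have hd : dist x y ^ 2 = (2 * Real.sin (angle x y / 2)) ^ 2 := by
    rw [dist_eq_norm, @norm_sub_sq_real, hx, hy, ← hcos]
    have h2 := Real.cos_two_mul (angle x y / 2)
    have h3 := Real.sin_sq_add_cos_sq (angle x y / 2)
    rw [mul_div_cancel₀ _ two_ne_zero] at h2
    nlinarith
  have hpos : 0 ≤ Real.sin (angle x y / 2) :=
    Real.sin_nonneg_of_nonneg_of_le_pi (by linarith) (by linarith)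
  have := (pow_left_inj₀ dist_nonneg (by positivity) two_ne_zero).1 hd
  rw [this]
  linarith

/-- A chord in a hyperplane orthogonal to the unit vector `u` is at most the diameter of the
slice. -/
theorem dist_le_two_mul_sin_angle {u a b : E} (hu : ‖u‖ = 1) (ha : ‖a‖ = 1) (hb : ‖b‖ = 1)
    (h : inner ℝ u a = inner ℝ u b) : dist a b ≤ 2 * Real.sin (angle u a) := by
  have hcos := cos_angle_of_norm_one hu ha
  have hsc := Real.sin_sq_add_cos_sq (angle u a)
  have hs := sin_angle_nonneg u a
  have key : ∀ x : E, ‖x‖ = 1 → inner ℝ u x = inner ℝ u a →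
      dist x (Real.cos (angle u a) • u) = Real.sin (angle u a) := by
    intro x hx hxa
    refine (pow_left_inj₀ dist_nonneg hs two_ne_zero).1 ?_
    rw [dist_eq_norm, @norm_sub_sq_real, inner_smul_right, norm_smul, hx, hu, mul_one,
      Real.norm_eq_abs, sq_abs, real_inner_comm, hxa, ← hcos]
    nlinarith
  have := dist_triangle_right a b (Real.cos (angle u a) • u)
  rw [key a ha rfl, key b hb h.symm] at this
  linarith

end Arcs

/-! ### From edge paths of the polytope to walks through empty cells. -/

section Cells

variable {n : ℕ} {N : Finset (UnitSphere n)} {ε : ℝ} {A : Set (UnitSphere n)}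
  {near : UnitSphere n → UnitSphere n}

/-- The points of the net `N` whose cell, the ball of radius `ε / 2`, contains no point of `A`. -/
def emptyCells (N : Finset (UnitSphere n)) (ε : ℝ) (A : Set (UnitSphere n)) :
    Set (UnitSphere n) :=
  {q | q ∈ N ∧ ∀ x ∈ A, ε / 2 ≤ dist q x}

/-- By `hA`, every point of `A` makes an angle at least `α` with the pole `u`. An arc point at angle
at most `α - 3 * ε` from `u` is thus at angle at least `3 * ε` from `A`, so at distance at least `3
* ε / 2` because `2 / π ≥ 1 / 2`. Its net point, within `ε`, stays `ε / 2` away from `A`. The walk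
jumps over the last stretch of length `3 * ε` next to `a` and then moves in steps of at most `ε`. -/
theorem walkWithin_near_pole (hε : 0 < ε) (hnear : ∀ x, near x ∈ N ∧ dist x (near x) ≤ ε)
    {u a : UnitSphere n} (hsin : 0 < Real.sin (angle u.1 a.1))
    (hα : 3 * ε ≤ angle u.1 a.1)
    (hA : ∀ x ∈ A, inner ℝ u.1 x.1 ≤ inner ℝ u.1 a.1) :
    WalkWithin (netGraph N (8 * ε)) (insert (near a) (emptyCells N ε A)) (near a) (near u) := by
  have hunit : ∀ x : UnitSphere n, ‖(x : EuclideanSpace ℝ (Fin n))‖ = 1 := fun x => by simp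
  obtain ⟨c, hc0, hcα, hcn, hcd, hca⟩ := exists_arc (hunit u) (hunit a) hsin
  have hπ := angle_le_pi (u : EuclideanSpace ℝ (Fin n)) a
  set α := angle u.1 a.1 with hαdef
  let d : ℝ → UnitSphere n := fun t => ⟨c t, by simpa using hcn t⟩
  have hdd : ∀ s t, dist (d s) (d t) ≤ |s - t| := hcd
  have hd0 : d 0 = u := Subtype.ext hc0
  have hdα : d α = a := Subtype.ext hcα
  have hstep : ∀ s t, dist (near (d s)) (near (d t)) ≤ |s - t| + 2 * ε := by
    intro s t
    have h1 := dist_triangle4 (near (d s)) (d s) (d t) (near (d t))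
    have h2 := (hnear (d s)).2
    rw [dist_comm] at h2
    linarith [(hnear (d t)).2, hdd s t]
  have hempty : ∀ t, 0 ≤ t → t ≤ α - 3 * ε → near (d t) ∈ emptyCells N ε A := by
    intro t h0 h1
    refine ⟨(hnear _).1, fun x hx => ?_⟩
    have h2 := angle_le_angle_of_inner_le (hunit u) (hunit a) (hunit x) (hA x hx)
    have h3 := angle_le_angle_add_angle u.1 (c t) x.1
    rw [hca t h0 (by linarith)] at h3
    have h4 := two_div_pi_mul_angle_le_dist (hcn t) (hunit x)
    have h5 : 1 / 2 ≤ 2 / Real.pi := by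
      rw [div_le_div_iff₀ two_pos Real.pi_pos]
      linarith [Real.pi_le_four]
    have h6 : 1 / 2 * (3 * ε) ≤ 2 / Real.pi * angle (c t) x.1 := by
      gcongr
      linarith
    have h7 : dist (d t) x ≤ dist (d t) (near (d t)) + dist (near (d t)) x := dist_triangle _ _ _
    have h8 : dist (d t) x = dist (c t) x.1 := rfl
    linarith [(hnear (d t)).2]
  -- Truncating the angle at `0` makes the walk stop exactly at the pole once `k` is large.
  have hreach : ∀ k : ℕ, WalkWithin (netGraph N (8 * ε)) (insert (near a) (emptyCells N ε A))
      (near a) (near (d (max 0 (α - 3 * ε - k * ε)))) := by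
    have hle : ∀ k : ℕ, max 0 (α - 3 * ε - k * ε) ≤ α - 3 * ε := by
      intro k
      have : 0 ≤ k * ε := by positivity
      exact max_le (by linarith) (by linarith)
    intro k
    induction k with
    | zero =>
      refine .of_dist_le (hnear _).1 (hnear _).1 (mem_insert _ _)
        (mem_insert_of_mem _ (hempty _ (le_max_left _ _) (hle 0))) ?_
      have h1 := hstep α (max 0 (α - 3 * ε - (0 : ℕ) * ε))
      rw [hdα] at h1
      refine h1.trans ?_
      have h2 : max 0 (α - 3 * ε - (0 : ℕ) * ε) = α - 3 * ε := by
        rw [Nat.cast_zero, zero_mul, sub_zero, max_eq_right (by linarith)]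
      rw [h2, abs_of_nonneg (by linarith)]
      linarith
    | succ k ih =>
      refine ih.trans (.of_dist_le (hnear _).1 (hnear _).1
        (mem_insert_of_mem _ (hempty _ (le_max_left _ _) (hle k)))
        (mem_insert_of_mem _ (hempty _ (le_max_left _ _) (hle (k + 1)))) ?_)
      refine (hstep _ _).trans ?_
      have h1 := abs_max_sub_max_le_abs (α - 3 * ε - k * ε) (α - 3 * ε - (k + 1 : ℕ) * ε) 0
      rw [max_comm, max_comm _ 0] at h1
      have h2 : α - 3 * ε - k * ε - (α - 3 * ε - (k + 1 : ℕ) * ε) = ε := by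
        push_cast
        ring
      rw [h2, abs_of_pos hε] at h1
      linarith
  obtain ⟨k, hk⟩ := exists_nat_ge ((α - 3 * ε) / ε)
  have h := hreach k
  rwa [max_eq_left, hd0] at h
  rw [div_le_iff₀ hε] at hk
  linarith

/-- Two points on the boundary of a cap without points of `A` are joined by a walk through empty
cells, with the possible exception of the cells of the two points themselves. -/
theorem walkWithin_near_of_cap (hε : 0 < ε) (hnear : ∀ x, near x ∈ N ∧ dist x (near x) ≤ ε)
    {u a b : UnitSphere n}
    (hab : inner ℝ u.1 a.1 = inner ℝ u.1 b.1)
    (hA : ∀ x ∈ A, inner ℝ u.1 x.1 ≤ inner ℝ u.1 a.1) :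
    WalkWithin (netGraph N (8 * ε)) ({near a, near b} ∪ emptyCells N ε A) (near a) (near b) := by
  have hunit : ∀ x : UnitSphere n, ‖(x : EuclideanSpace ℝ (Fin n))‖ = 1 := fun x => by simp
  -- Close ends are joined in one step of at most `6 * ε + 2 * ε`, which fixes the radius `8 * ε` of
  -- the graph. Otherwise the slice has diameter above `6 * ε`, so the cap has angle at least `3 *
  -- ε`.
  by_cases hd : dist a b ≤ 6 * ε
  · refine .of_dist_le (hnear a).1 (hnear b).1 (by simp) (by simp) ?_
    have h1 := dist_triangle4 (near a) a b (near b)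
    have h2 := (hnear a).2
    rw [dist_comm] at h2
    linarith [(hnear b).2]
  · push Not at hd
    have hangle : angle u.1 a.1 = angle u.1 b.1 := by
      rw [angle, angle, hunit, hunit, hunit, hab]
    have h1 : dist a b ≤ _ := dist_le_two_mul_sin_angle (hunit u) (hunit a) (hunit b) hab
    have h2 : 3 * ε ≤ Real.sin (angle u.1 a.1) := by linarith
    have h3 := Real.sin_le (angle_nonneg (u : EuclideanSpace ℝ (Fin n)) a)
    have hwa := walkWithin_near_pole hε hnear (u := u) (a := a) (A := A) (by linarith)
      (by linarith) hA
    have hwb := walkWithin_near_pole hε hnear (u := u) (a := b) (A := A) (by rw [← hangle]; linarith)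
      (by rw [← hangle]; linarith) (by rw [← hab]; exact hA)
    refine (hwa.mono ?_).trans (hwb.symm.mono ?_)
    · exact insert_subset (by simp) subset_union_right
    · exact insert_subset (by simp) subset_union_right

/-- The ends of an edge of an inscribed polytope lie on the boundary of a cap without vertices. -/
theorem exists_cap_of_isExposed_segment (hn : 2 ≤ n) {a b : UnitSphere n}
    (h : IsExposed ℝ (convexHull ℝ (Subtype.val '' A))
      (segment ℝ (a : EuclideanSpace ℝ (Fin n)) b)) :
    ∃ u : UnitSphere n, inner ℝ u.1 a.1 = inner ℝ u.1 b.1 ∧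
      ∀ x ∈ A, inner ℝ u.1 x.1 ≤ inner ℝ u.1 a.1 := by
  suffices hv : ∃ v : EuclideanSpace ℝ (Fin n), v ≠ 0 ∧ inner ℝ v a.1 = inner ℝ v b.1 ∧
      ∀ x ∈ A, inner ℝ v x.1 ≤ inner ℝ v a.1 by
    obtain ⟨v, hv0, hvab, hvA⟩ := hv
    refine ⟨⟨‖v‖⁻¹ • v, by simp [norm_smul, hv0]⟩, ?_, fun x hx => ?_⟩
    · rw [inner_smul_left, inner_smul_left, hvab]
    · rw [inner_smul_left, inner_smul_left, conj_trivial]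
      exact mul_le_mul_of_nonneg_left (hvA x hx) (by positivity)
  obtain ⟨l, hl⟩ := h ⟨a, left_mem_segment ℝ _ _⟩
  have ha := left_mem_segment ℝ (a : EuclideanSpace ℝ (Fin n)) b
  have hb := right_mem_segment ℝ (a : EuclideanSpace ℝ (Fin n)) b
  have hAP : ∀ x ∈ A, (x : EuclideanSpace ℝ (Fin n)) ∈ convexHull ℝ (Subtype.val '' A) :=
    fun x hx => subset_convexHull ℝ _ ⟨x, hx, rfl⟩
  -- The exposing functional may vanish, when the polytope is the segment itself. Any nonzero vector
  -- orthogonal to the segment then serves, and exists because `n ≥ 2`.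
  by_cases hl0 : l = 0
  · have hseg : ∀ x ∈ A, (x : EuclideanSpace ℝ (Fin n)) ∈ segment ℝ a.1 b.1 := by
      intro x hx
      rw [hl]
      exact ⟨hAP x hx, by simp [hl0]⟩
    have hne : (ℝ ∙ ((b : EuclideanSpace ℝ (Fin n)) - a))ᗮ ≠ ⊥ := by
      intro hbot
      have h1 := Submodule.finrank_add_finrank_orthogonal (ℝ ∙ ((b : EuclideanSpace ℝ (Fin n)) - a))
      rw [hbot, finrank_bot, finrank_euclideanSpace_fin] at h1
      have h2 := finrank_span_le_card (R := ℝ) {(b : EuclideanSpace ℝ (Fin n)) - a}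
      rw [toFinset_singleton, Finset.card_singleton] at h2
      omega
    obtain ⟨v, hv, hv0⟩ := Submodule.exists_mem_ne_zero_of_ne_bot hne
    have hvab : inner ℝ v ((b : EuclideanSpace ℝ (Fin n)) - a) = 0 :=
      Submodule.mem_orthogonal_singleton_iff_inner_left.1 hv
    refine ⟨v, hv0, ?_, fun x hx => ?_⟩
    · rw [inner_sub_right] at hvab
      linarith
    · obtain ⟨t, -, ht⟩ := (segment_eq_image' ℝ (a : EuclideanSpace ℝ (Fin n)) b).subset (hseg x hx)
      simp only at ht
      rw [← ht, inner_add_right, inner_smul_right, hvab]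
      simp
  · refine ⟨(InnerProductSpace.toDual ℝ _).symm l, by simpa using hl0, ?_, fun x hx => ?_⟩
    · simp only [InnerProductSpace.toDual_symm_apply]
      rw [hl] at ha hb
      exact le_antisymm (hb.2 _ ha.1) (ha.2 _ hb.1)
    · simp only [InnerProductSpace.toDual_symm_apply]
      rw [hl] at ha
      exact ha.2 _ (hAP x hx)

/-- A path along edges of an inscribed polytope gives rise to a walk in the net, all of whose cells
are empty except for those of the vertices on the path. -/
theorem walkWithin_of_walk (hn : 2 ≤ n) (hε : 0 < ε)
    (hnear : ∀ x, near x ∈ N ∧ dist x (near x) ≤ ε)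
    (φ : (convexHull ℝ (Subtype.val '' A)).extremePoints ℝ → UnitSphere n)
    (hφ : ∀ v, (φ v : EuclideanSpace ℝ (Fin n)) = v)
    {v w : (convexHull ℝ (Subtype.val '' A)).extremePoints ℝ}
    (p : (polytopeGraph (convexHull ℝ (Subtype.val '' A))).Walk v w) :
    WalkWithin (netGraph N (8 * ε)) ((fun x => near (φ x)) '' {x | x ∈ p.support} ∪ emptyCells N ε A)
      (near (φ v)) (near (φ w)) := by
  induction p with
  | nil => exact .refl (by simp)
  | @cons x y z h p ih =>
    have h2 := h.2
    rw [← hφ, ← hφ] at h2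
    obtain ⟨u, hu, huA⟩ := exists_cap_of_isExposed_segment hn h2
    refine ((walkWithin_near_of_cap hε hnear hu huA).mono ?_).trans (ih.mono ?_)
    · refine union_subset_union_left _ ?_
      rintro q (rfl | rfl)
      · exact ⟨x, by simp, rfl⟩
      · exact ⟨y, by simp, rfl⟩
    · refine union_subset_union_left _ (image_mono fun t ht => ?_)
      simp only [SimpleGraph.Walk.support_cons, List.mem_cons, mem_ofPred_eq] at ht ⊢
      exact Or.inr ht

/-- Strict convexity of the ball makes every sample point a vertex, so the two distant sample points
can serve as ends of an edge path. -/
theorem mem_extremePoints_convexHull {a : UnitSphere n} (ha : a ∈ A) :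
    (a : EuclideanSpace ℝ (Fin n)) ∈ (convexHull ℝ (Subtype.val '' A)).extremePoints ℝ := by
  refine inter_extremePoints_subset_extremePoints_of_subset (A := closedBall 0 1) ?_
    ⟨subset_convexHull ℝ _ ⟨a, ha, rfl⟩, ?_⟩
  · refine convexHull_min ?_ (convex_closedBall _ _)
    rintro _ ⟨x, -, rfl⟩
    simp
  · exact StrictConvexSpace.sphere_subset_extremePoints_closedBall _ one_ne_zero a.2

open Classical in
/-- If an inscribed polytope has distant vertices and small combinatorial diameter, then there is a
long path in the net on which few cells contain vertices. -/
theorem exists_path_of_combDiam_lt (hn : 2 ≤ n) (hε : 0 < ε) (hε' : ε ≤ 1 / 4)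
    (hnear : ∀ x, near x ∈ N ∧ dist x (near x) ≤ ε) {a b : UnitSphere n} (ha : a ∈ A) (hb : b ∈ A)
    (hab : 1 ≤ dist a b) {X : ℝ}
    (hX : ((combDiam (convexHull ℝ (Subtype.val '' A)) : ℕ∞) : ℝ≥0∞) < ENNReal.ofReal X) {L : ℕ}
    (hL : (L : ℝ) < 1 / (16 * ε) + 1) :
    ∃ l : List (UnitSphere n), l.length = L ∧ l.IsChain (netGraph N (8 * ε)).Adj ∧ l.Nodup ∧
      (∀ q ∈ l, q ∈ N) ∧ ((l.toFinset.filter (· ∉ emptyCells N ε A)).card : ℝ) ≤ X + 1 := by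
  set P := convexHull ℝ (Subtype.val '' A) with hP
  let v : P.extremePoints ℝ := ⟨a, mem_extremePoints_convexHull ha⟩
  let w : P.extremePoints ℝ := ⟨b, mem_extremePoints_convexHull hb⟩
  have hφ : ∀ x : P.extremePoints ℝ, ∃ y : UnitSphere n, (y : EuclideanSpace ℝ (Fin n)) = x := by
    intro x
    obtain ⟨y, -, hy⟩ := extremePoints_convexHull_subset x.2
    exact ⟨y, hy⟩
  choose φ hφ using hφ
  have hφv : φ v = a := Subtype.ext (hφ v)
  have hφw : φ w = b := Subtype.ext (hφ w)
  have hdist : (((polytopeGraph P).edist v w : ℕ∞) : ℝ≥0∞) < ENNReal.ofReal X := by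
    refine lt_of_le_of_lt ?_ hX
    exact_mod_cast SimpleGraph.edist_le_ediam
  obtain ⟨p, hp⟩ := SimpleGraph.exists_walk_of_edist_ne_top (G := polytopeGraph P) (u := v) (v := w)
    (by rintro h; rw [h] at hdist; simp at hdist)
  have hpX : (p.length : ℝ) < X := by
    rw [← hp] at hdist
    have : ENNReal.ofReal (p.length : ℝ) < ENNReal.ofReal X := by simpa using hdist
    exact (ENNReal.ofReal_lt_ofReal_iff_of_nonneg (by positivity)).1 this
  obtain ⟨g, hg⟩ := walkWithin_of_walk hn hε hnear φ hφ p
  -- Removing loops makes the visited net points distinct, so their cells are disjoint and emptiness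
  -- can be counted.
  have hsub := g.support_bypass_subset_support
  have hpath := g.bypass_isPath
  set g' := g.bypass
  have hlen : L ≤ g'.support.length := by
    have h1 : dist (near a) (near b) ≤ g'.length * (8 * ε) := by
      rw [← hφv, ← hφw]
      exact dist_le_length_mul g'
    have h2 := dist_triangle4 a (near a) (near b) b
    have h3 := (hnear b).2
    rw [dist_comm] at h3
    -- The net points of the ends are at distance at least `1 - 2 * ε ≥ 1 / 2`, and each step covers
    -- at most `8 * ε`.
    have h4 : 1 / 2 ≤ g'.length * (8 * ε) := by linarith [(hnear a).2]
    have h5 : 1 / (16 * ε) ≤ g'.length := by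
      rw [div_le_iff₀ (by positivity)]
      linarith
    rw [SimpleGraph.Walk.length_support]
    have h6 : (L : ℝ) < (g'.length + 1 : ℕ) := by
      push_cast
      linarith
    exact (Nat.cast_lt.1 h6).le
  have hmem : ∀ q ∈ g'.support.take L,
      q ∈ (fun x => near (φ x)) '' {x | x ∈ p.support} ∪ emptyCells N ε A :=
    fun q hq => hg q (hsub (List.mem_of_mem_take hq))
  refine ⟨g'.support.take L, by simpa using hlen, g'.isChain_adj_support.take L,
    hpath.support_nodup.sublist (List.take_sublist _ _), ?_, ?_⟩
  · intro q hq
    rcases hmem q hq with ⟨x, -, rfl⟩ | h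
    exacts [(hnear _).1, h.1]
  · have hcard : ((g'.support.take L).toFinset.filter (· ∉ emptyCells N ε A)).card ≤
        p.length + 1 := by
      calc _ ≤ ((p.support.map fun x => near (φ x)).toFinset).card := by
            refine Finset.card_le_card fun q hq => ?_
            simp only [Finset.mem_filter, List.mem_toFinset] at hq
            rcases hmem q hq.1 with ⟨x, hx, rfl⟩ | h
            · simp only [List.mem_toFinset, List.mem_map]
              exact ⟨x, hx, rfl⟩
            · exact absurd h hq.2
        _ ≤ p.length + 1 := by
            refine (List.toFinset_card_le _).trans ?_
            simp
    have : (((g'.support.take L).toFinset.filter (· ∉ emptyCells N ε A)).card : ℝ) ≤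
        p.length + 1 := by exact_mod_cast hcard
    linarith

end Cells

end RandomPolytope

namespace RandomPolytope

open Metric Set

/-! ### Counting walks in the net. -/

section Counting

open Classical in
/-- In a graph of maximal degree `D` there are at most `|N| * D ^ k` walks with `k` steps. -/
theorem exists_finset_chains {X : Type*} [PseudoMetricSpace X] (N : Finset X) (r : ℝ) (D : ℕ)
    (hD : ∀ q : X, (N.filter fun p => dist p q ≤ r).card ≤ D) (k : ℕ) :
    ∃ F : Finset (List X), F.card ≤ N.card * D ^ k ∧ ∀ l : List X, l.length = k + 1 →
      l.IsChain (netGraph N r).Adj → (∀ q ∈ l, q ∈ N) → l ∈ F := by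
  induction k with
  | zero =>
    refine ⟨N.image fun q => [q], by simpa using Finset.card_image_le, fun l hl _ hN => ?_⟩
    obtain ⟨q, rfl⟩ := List.length_eq_one_iff.1 hl
    exact Finset.mem_image.2 ⟨q, hN q (by simp), rfl⟩
  | succ k ih =>
    obtain ⟨F, hF, hmem⟩ := ih
    let ext : List X → Finset (List X) := fun l => match l with
      | [] => ∅
      | q :: t => (N.filter fun p => dist p q ≤ r).image fun p => p :: q :: t
    have hext : ∀ l ∈ F, (ext l).card ≤ D := by
      rintro (_ | ⟨q, t⟩) -
      · simp [ext]
      · exact Finset.card_image_le.trans (hD q)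
    refine ⟨F.biUnion ext, ?_, fun l hl hchain hN => ?_⟩
    · calc (F.biUnion ext).card ≤ F.card * D := Finset.card_biUnion_le_card_mul _ _ _ hext
        _ ≤ N.card * D ^ k * D := Nat.mul_le_mul_right _ hF
        _ = N.card * D ^ (k + 1) := by rw [pow_succ, mul_assoc]
    · match l, hl with
      | p :: q :: t, hl =>
        rw [List.isChain_cons_cons] at hchain
        refine Finset.mem_biUnion.2 ⟨q :: t, hmem _ (by simpa using hl) hchain.2
          fun x hx => hN x (List.mem_cons_of_mem _ hx), ?_⟩
        exact Finset.mem_image.2 ⟨p, Finset.mem_filter.2 ⟨hN p (by simp), hchain.1.2.2.2⟩, rfl⟩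
      | [p], hl => simp at hl

end Counting

/-! ### Union bound over paths and sets of empty cells. -/

section Probability

variable {Ω : Type*} [MeasurableSpace Ω] {μ : Measure Ω} [IsProbabilityMeasure μ] {n : ℕ}
  {m : ℝ≥0} {M : Ω → ℕ} {a : ℕ → Ω → UnitSphere n}

/-- The probability that all cells about the points of `S` are empty. -/
theorem IsPoissonSample.measure_cells_empty_le (h : IsPoissonSample μ n m M a) (hn : n ≠ 0) {ε : ℝ}
    (hε : 0 < ε) (hε1 : ε ≤ 1) (S : Finset (UnitSphere n))
    (hsep : (S : Set (UnitSphere n)).Pairwise fun p q => ε ≤ dist p q) :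
    μ {ω | ∀ q ∈ S, ∀ i < M ω, a i ω ∉ ball q (ε / 2)} ≤
      ENNReal.ofReal (Real.exp (-(m * (S.card * ((1 / 16) ^ n * (ε / 2) ^ (n - 1)))))) := by
  have hdisj : Set.Pairwise (S : Set (UnitSphere n))
      (Function.onFun Disjoint fun q => ball q (ε / 2)) := by
    intro p hp q hq hpq
    apply ball_disjoint_ball
    linarith [hsep hp hq hpq]
  refine le_trans (measure_mono fun ω hω => ?_) (h.measure_forall_notMem_le
    (T := ⋃ q ∈ S, ball q (ε / 2)) (Finset.measurableSet_biUnion _ fun q _ => measurableSet_ball) ?_)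
  · intro i hi
    simp only [mem_iUnion, not_exists]
    exact fun q hq => hω q hq i hi
  · rw [measure_biUnion_finset hdisj fun q _ => measurableSet_ball,
      ENNReal.ofReal_mul (by positivity), ENNReal.ofReal_natCast, ← nsmul_eq_mul]
    exact Finset.card_nsmul_le_sum _ _ _ fun q _ =>
      ofReal_le_uniformSphere_ball hn q (half_pos hε) (by linarith)

open Classical in
/-- The probability that there is a long path in the net few of whose cells contain sample
points. -/
theorem IsPoissonSample.measure_exists_path_le (h : IsPoissonSample μ n m M a) (hn : n ≠ 0) {ε : ℝ}
    (hε : 0 < ε) (hε1 : ε ≤ 1) (N : Finset (UnitSphere n))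
    (hsep : (N : Set (UnitSphere n)).Pairwise fun p q => ε ≤ dist p q) {L : ℕ} (hL : L ≠ 0)
    (Y : ℝ) :
    μ {ω | ∃ l : List (UnitSphere n), l.length = L ∧ l.IsChain (netGraph N (8 * ε)).Adj ∧
        l.Nodup ∧ (∀ q ∈ l, q ∈ N) ∧ ((l.toFinset.filter
          (· ∉ emptyCells N ε ((fun i => a i ω) '' {i | i < M ω}))).card : ℝ) ≤ Y} ≤
      ENNReal.ofReal ((1 + 2 / ε) ^ n * 17 ^ (n * L) * 2 ^ L *
        Real.exp (-(m * ((L - Y) * ((1 / 16) ^ n * (ε / 2) ^ (n - 1)))))) := by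
  set B : ℝ := Real.exp (-(m * ((L - Y) * ((1 / 16) ^ n * (ε / 2) ^ (n - 1))))) with hB
  have hNcard : (N.card : ℝ) ≤ (1 + 2 / ε) ^ n := by
    simpa using card_le_of_pairwise_le_dist_sphere N 0 hε zero_le_one hsep (by simp)
  have hD : ∀ q : UnitSphere n, (N.filter fun p => dist p q ≤ 8 * ε).card ≤ 17 ^ n := by
    intro q
    have h1 := card_le_of_pairwise_le_dist_sphere (N.filter fun p => dist p q ≤ 8 * ε) q hε
      (by positivity : 0 ≤ 8 * ε) (hsep.mono (Finset.coe_subset.2 (Finset.filter_subset _ _))) (fun p hp => (Finset.mem_filter.1 hp).2)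
    -- The degree bound is the packing bound with `R = 8 * ε`. Using the ambient dimension `n`
    -- instead of `n - 1` only affects constants.
    rw [show 1 + 2 * (8 * ε) / ε = 17 by field_simp; norm_num] at h1
    exact_mod_cast h1
  obtain ⟨F, hF, hmem⟩ := exists_finset_chains N (8 * ε) (17 ^ n) hD (L - 1)
  rw [Nat.sub_add_cancel (Nat.one_le_iff_ne_zero.2 hL)] at hmem
  have hFcard : (F.card : ℝ) ≤ (1 + 2 / ε) ^ n * 17 ^ (n * L) := by
    calc (F.card : ℝ) ≤ N.card * (17 ^ n) ^ (L - 1) := by exact_mod_cast hF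
      _ ≤ (1 + 2 / ε) ^ n * (17 ^ n) ^ L := by
          gcongr
          · exact one_le_pow₀ (by norm_num)
          · omega
      _ = _ := by rw [pow_mul]
  let F' := F.filter fun l => l.length = L ∧ l.Nodup ∧ ∀ q ∈ l, q ∈ N
  -- Which points of the path have empty cells is random, so the union also runs over all subsets of
  -- size at least `L - Y`.
  let G : List (UnitSphere n) → Finset (Finset (UnitSphere n)) := fun l =>
    l.toFinset.powerset.filter fun S => L - Y ≤ (S.card : ℝ)
  have hG : ∀ l ∈ F', ((G l).card : ℝ) ≤ 2 ^ L := by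
    intro l hl
    have h1 : (G l).card ≤ 2 ^ L := by
      refine (Finset.card_filter_le _ _).trans ?_
      rw [Finset.card_powerset]
      exact Nat.pow_le_pow_right two_pos
        ((List.toFinset_card_le l).trans (Finset.mem_filter.1 hl).2.1.le)
    exact_mod_cast h1
  have hev : ∀ l ∈ F', ∀ S ∈ G l,
      μ {ω | ∀ q ∈ S, ∀ i < M ω, a i ω ∉ ball q (ε / 2)} ≤ ENNReal.ofReal B := by
    intro l hl S hS
    simp only [G, Finset.mem_filter, Finset.mem_powerset] at hS
    simp only [F', Finset.mem_filter] at hl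
    refine (h.measure_cells_empty_le hn hε hε1 S (hsep.mono fun q hq => ?_)).trans ?_
    · exact hl.2.2.2 q (List.mem_toFinset.1 (hS.1 hq))
    · rw [hB]
      gcongr
      exact hS.2
  calc _ ≤ μ (⋃ l ∈ F', ⋃ S ∈ G l, {ω | ∀ q ∈ S, ∀ i < M ω, a i ω ∉ ball q (ε / 2)}) := by
        refine measure_mono ?_
        rintro ω ⟨l, hlen, hchain, hnodup, hlN, hcard⟩
        have hl : l ∈ F' := Finset.mem_filter.2 ⟨hmem l hlen hchain hlN, hlen, hnodup, hlN⟩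
        refine mem_iUnion₂.2 ⟨l, hl, mem_iUnion₂.2 ⟨l.toFinset.filter
          (· ∈ emptyCells N ε ((fun i => a i ω) '' {i | i < M ω})), ?_, ?_⟩⟩
        · refine Finset.mem_filter.2 ⟨Finset.mem_powerset.2 (Finset.filter_subset _ _), ?_⟩
          have h1 := Finset.card_filter_add_card_filter_not (s := l.toFinset)
            (· ∈ emptyCells N ε ((fun i => a i ω) '' {i | i < M ω}))
          rw [List.toFinset_card_of_nodup hnodup, hlen] at h1
          have h2 := congrArg (Nat.cast (R := ℝ)) h1
          push_cast at h2
          linarith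
        · intro q hq i hi
          have h1 := (Finset.mem_filter.1 hq).2.2 (a i ω) ⟨i, hi, rfl⟩
          rw [mem_ball, dist_comm, not_lt]
          exact h1
    _ ≤ ∑ l ∈ F', ∑ S ∈ G l, μ {ω | ∀ q ∈ S, ∀ i < M ω, a i ω ∉ ball q (ε / 2)} :=
        (measure_biUnion_finset_le _ _).trans
          (Finset.sum_le_sum fun l _ => measure_biUnion_finset_le _ _)
    _ ≤ ∑ l ∈ F', ∑ S ∈ G l, ENNReal.ofReal B :=
        Finset.sum_le_sum fun l hl => Finset.sum_le_sum fun S hS => hev l hl S hS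
    _ ≤ ∑ l ∈ F', ENNReal.ofReal (2 ^ L * B) := by
        refine Finset.sum_le_sum fun l hl => ?_
        rw [Finset.sum_const, nsmul_eq_mul, ← ENNReal.ofReal_natCast,
          ← ENNReal.ofReal_mul (by positivity)]
        gcongr
        exact hG l hl
    _ ≤ _ := by
        rw [Finset.sum_const, nsmul_eq_mul, ← ENNReal.ofReal_natCast,
          ← ENNReal.ofReal_mul (by positivity), mul_assoc _ _ B]
        gcongr
        refine le_trans ?_ hFcard
        exact_mod_cast Finset.card_filter_le _ _

/-- A bound for the probability that the combinatorial diameter is small, with a free scale `ε`. -/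
theorem IsPoissonSample.measure_combDiam_lt_le (h : IsPoissonSample μ n m M a) (hn : 2 ≤ n)
    {ε : ℝ} (hε : 0 < ε) (hε' : ε ≤ 1 / 4) {L : ℕ} (hL : L ≠ 0) (hL' : (L : ℝ) < 1 / (16 * ε) + 1)
    (X : ℝ) :
    μ {ω | ((combDiam (hullOfFirst (M ω) (fun i => a i ω)) : ℕ∞) : ℝ≥0∞) < ENNReal.ofReal X} ≤
      ENNReal.ofReal ((1 + 2 / ε) ^ n * 17 ^ (n * L) * 2 ^ L *
        Real.exp (-(m * ((L - (X + 1)) * ((1 / 16) ^ n * (ε / 2) ^ (n - 1)))))) +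
      (ENNReal.ofReal (Real.exp (-(m * ((1 / 16) ^ n * (1 / 2) ^ (n - 1))))) +
       ENNReal.ofReal (Real.exp (-(m * ((1 / 16) ^ n * (1 / 2) ^ (n - 1)))))) := by
  classical
  obtain ⟨N, hsep, hdense⟩ := exists_finset_separated_dense (UnitSphere n) hε
  choose near hnear using hdense
  -- Sample points within `1 / 2` of `e` and of `-e` are at distance at least `2 - 1 / 2 - 1 / 2 =
  -- 1`.
  let e : UnitSphere n := ⟨EuclideanSpace.single ⟨0, by omega⟩ 1, by simp⟩
  have hcap : ∀ q : UnitSphere n, μ {ω | ∀ i < M ω, a i ω ∉ ball q (1 / 2)} ≤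
      ENNReal.ofReal (Real.exp (-(m * ((1 / 16) ^ n * (1 / 2) ^ (n - 1))))) := fun q =>
    h.measure_forall_notMem_le measurableSet_ball
      (ofReal_le_uniformSphere_ball (by omega) q (by norm_num) (by norm_num))
  refine le_trans ?_ (add_le_add (h.measure_exists_path_le (by omega) hε (by linarith) N hsep hL
    (X + 1)) (add_le_add (hcap e) (hcap (-e))))
  refine le_trans (measure_mono fun ω hω => ?_) ((measure_union_le _ _).trans
    (add_le_add le_rfl (measure_union_le _ _)))
  by_cases h1 : ∀ i < M ω, a i ω ∉ ball e (1 / 2)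
  · exact Or.inr (Or.inl h1)
  by_cases h2 : ∀ i < M ω, a i ω ∉ ball (-e) (1 / 2)
  · exact Or.inr (Or.inr h2)
  push Not at h1 h2
  obtain ⟨i, hi, hie⟩ := h1
  obtain ⟨j, hj, hje⟩ := h2
  refine Or.inl ?_
  have hhull : hullOfFirst (M ω) (fun i => a i ω) =
      convexHull ℝ (Subtype.val '' ((fun i => a i ω) '' {i | i < M ω})) := by
    rw [hullOfFirst, image_image]
  have hω' : ((combDiam (hullOfFirst (M ω) (fun i => a i ω)) : ℕ∞) : ℝ≥0∞) < ENNReal.ofReal X := hω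
  rw [hhull] at hω'
  refine exists_path_of_combDiam_lt (A := (fun i => a i ω) '' {i | i < M ω}) hn hε hε' hnear
    (a := a i ω) (b := a j ω) ⟨i, hi, rfl⟩
    ⟨j, hj, rfl⟩ ?_ hω' hL'
  have h3 : dist e (-e) = 2 := by
    rw [Subtype.dist_eq, dist_eq_norm]
    have : (e : EuclideanSpace ℝ (Fin n)) - ((-e : UnitSphere n) : EuclideanSpace ℝ (Fin n)) =
        (2 : ℝ) • (e : EuclideanSpace ℝ (Fin n)) := by
      rw [two_smul]
      simp
    rw [this, norm_smul]
    simp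
  have h4 := dist_triangle4 e (a i ω) (a j ω) (-e)
  rw [mem_ball] at hie hje
  rw [dist_comm] at hie
  linarith

end Probability

end RandomPolytope

namespace RandomPolytope

/-! ### Numerical estimates for the chosen constants. -/

section Constants

/-- With `y = 1 / ε`, so that `k = 512 * 2 ^ 20 * y`, this compares exponents per unit of `y`: the
target `2 ^ (d + 1) * k` and the counting cost, against the gain from emptiness. -/
theorem net_exponent_bound {d : ℕ} (hd : 2 ≤ d) :
    2 ^ (d + 1) * (512 * 2 ^ 20) + 3 * (d + 1 : ℝ) ≤ (2 ^ 20) ^ d / 32 := by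
  obtain ⟨e, rfl⟩ := Nat.exists_eq_add_of_le hd
  have h1 : ((e : ℝ) + 1) ≤ 2 ^ e := by exact_mod_cast Nat.lt_two_pow_self (n := e)
  have h2 : (2 : ℝ) ^ e ≤ (2 ^ 20) ^ e := pow_le_pow_left₀ (by norm_num) (by norm_num) e
  rw [pow_add _ 2 e, show 2 + e + 1 = e + 3 by ring, pow_add 2 e 3]
  push_cast
  generalize ((2 : ℝ) ^ 20) ^ e = T at *
  generalize (2 : ℝ) ^ e = S at *
  norm_num
  linarith

/-- The case `d = 2` needs only `k ≥ 2 ^ 21`, and each further dimension multiplies the right side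
by more than `2`. For `d = 1` it fails, which is where `n ≥ 3` matters. -/
theorem cap_exponent_bound {d : ℕ} (hd : 2 ≤ d) {k : ℝ} (hk : 2 ^ 35 ≤ k) :
    2 ^ (d + 1) * k ≤ (k / 512) ^ d := by
  obtain ⟨e, rfl⟩ := Nat.exists_eq_add_of_le hd
  have h1 : (2 : ℝ) ^ e ≤ (k / 512) ^ e := pow_le_pow_left₀ (by norm_num) (by linarith) e
  rw [pow_add _ 2 e, show 2 + e + 1 = e + 3 by ring, pow_add 2 e 3]
  have h2 : 2 ^ 3 * k ≤ (k / 512) ^ 2 := by nlinarith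
  calc 2 ^ e * 2 ^ 3 * k = (2 ^ 3 * k) * 2 ^ e := by ring
    _ ≤ (k / 512) ^ 2 * (k / 512) ^ e := by gcongr

/-- The counting factor is absorbed by the exponentially small probability of emptiness. -/
theorem net_term_le {d : ℕ} (hd : 2 ≤ d) {k : ℝ} (hk : 2 ^ 35 ≤ k) {L : ℕ}
    (hL : 1 / (16 * (512 * 2 ^ 20 / k)) ≤ (L : ℝ))
    (hL' : (L : ℝ) < 1 / (16 * (512 * 2 ^ 20 / k)) + 1) :
    (1 + 2 / (512 * 2 ^ 20 / k)) ^ (d + 1) * 17 ^ ((d + 1) * L) * 2 ^ L *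
      Real.exp (-(k ^ d * ((L - ((2 ^ 35)⁻¹ * k + 1)) *
        ((1 / 16) ^ (d + 1) * (512 * 2 ^ 20 / k / 2) ^ d)))) ≤
      Real.exp (-(2 ^ (d + 1) * k)) := by
  have hk0 : 0 < k := by linarith
  obtain ⟨y, rfl⟩ : ∃ y : ℝ, k = 512 * 2 ^ 20 * y := ⟨k / (512 * 2 ^ 20), by field_simp⟩
  have hy : 64 ≤ y := by linarith
  have hε : 512 * 2 ^ 20 / (512 * 2 ^ 20 * y) = 1 / y := by field_simp
  have hLy : 1 / (16 * (1 / y)) = y / 16 := by field_simp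
  rw [hε, hLy] at hL hL'
  rw [hε]
  have hL8 : (L : ℝ) ≤ y / 8 := by linarith
  have e1 : (1 + 2 / (1 / y)) ^ (d + 1) ≤ Real.exp ((d + 1) * (2 * y)) := by
    have h1 : 1 + 2 / (1 / y) ≤ Real.exp (2 * y) := by
      have := Real.add_one_le_exp (2 * y)
      rw [div_div_eq_mul_div, div_one]
      linarith
    refine (pow_le_pow_left₀ (by positivity) h1 _).trans ?_
    rw [← Real.exp_nat_mul]
    push_cast
    exact le_rfl
  have e2 : (17 : ℝ) ^ ((d + 1) * L) ≤ Real.exp ((d + 1) * (3 * (y / 8))) := by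
    have h1 : (17 : ℝ) ≤ Real.exp 3 := by
      have h2 : Real.exp 3 = Real.exp 1 ^ 3 := by rw [← Real.exp_nat_mul]; norm_num
      have h3 := Real.exp_one_gt_d9
      rw [h2]
      calc (17 : ℝ) ≤ 2.7 ^ 3 := by norm_num
        _ ≤ Real.exp 1 ^ 3 := by gcongr; linarith
    refine (pow_le_pow_left₀ (by positivity) h1 _).trans ?_
    rw [← Real.exp_nat_mul, Real.exp_le_exp]
    push_cast
    have : 0 ≤ (d : ℝ) + 1 := by positivity
    nlinarith
  have e3 : (2 : ℝ) ^ L ≤ Real.exp (y / 8) := by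
    have h1 : (2 : ℝ) ≤ Real.exp 1 := by linarith [Real.exp_one_gt_d9]
    refine (pow_le_pow_left₀ (by positivity) h1 _).trans ?_
    rw [← Real.exp_nat_mul, Real.exp_le_exp]
    linarith
  have e4 : y / 32 * (2 ^ 20) ^ d ≤ (512 * 2 ^ 20 * y) ^ d *
      ((L - ((2 ^ 35)⁻¹ * (512 * 2 ^ 20 * y) + 1)) * ((1 / 16) ^ (d + 1) * (1 / y / 2) ^ d)) := by
    -- The factor `512 = 16 * 2 * 16` in `ε` cancels the losses `1 / 16` and `1 / 2` in the measure
    -- of a cell. The spare `16 ^ d` pays for the one remaining `1 / 16`.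
    have h1 : (512 * 2 ^ 20 * y) ^ d * ((1 / 16) ^ (d + 1) * (1 / y / 2) ^ d) =
        (2 ^ 20) ^ d * (16 ^ d / 16) := by
      rw [pow_succ (1 / 16 : ℝ) d, ← mul_assoc, ← mul_assoc, ← mul_pow, mul_right_comm _ (1 / 16 : ℝ), ← mul_pow,
        show 512 * 2 ^ 20 * y * (1 / 16) * (1 / y / 2) = 2 ^ 20 * 16 by field_simp; norm_num,
        mul_pow]
      ring
    have h2 : (1 : ℝ) ≤ 16 ^ d / 16 := by
      rw [le_div_iff₀ (by norm_num), one_mul]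
      exact le_self_pow₀ (by norm_num) (by omega)
    -- Here `L ≥ y / 16`, the diameter threshold `2⁻³⁵ * k` equals `y / 64`, and `1 ≤ y / 64`.
    have h3 : y / 32 ≤ L - ((2 ^ 35)⁻¹ * (512 * 2 ^ 20 * y) + 1) := by
      norm_num
      linarith
    calc y / 32 * (2 ^ 20) ^ d = y / 32 * ((2 ^ 20) ^ d * 1) := by ring
      _ ≤ (L - ((2 ^ 35)⁻¹ * (512 * 2 ^ 20 * y) + 1)) * ((2 ^ 20) ^ d * (16 ^ d / 16)) := by
          gcongr
          linarith
      _ = _ := by rw [← h1]; ring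
  calc _ ≤ Real.exp ((d + 1) * (2 * y)) * Real.exp ((d + 1) * (3 * (y / 8))) * Real.exp (y / 8) *
        Real.exp (-(y / 32 * (2 ^ 20) ^ d)) := by gcongr
    _ ≤ _ := by
        rw [← Real.exp_add, ← Real.exp_add, ← Real.exp_add, Real.exp_le_exp]
        have h1 := mul_le_mul_of_nonneg_left (net_exponent_bound hd) (by linarith : 0 ≤ y)
        have h2 : 0 ≤ (d : ℝ) * y := by positivity
        linarith

theorem cap_term_le {d : ℕ} (hd : 2 ≤ d) {k : ℝ} (hk : 2 ^ 35 ≤ k) :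
    Real.exp (-(k ^ d * ((1 / 16) ^ (d + 1) * (1 / 2) ^ d))) ≤ Real.exp (-(2 ^ (d + 1) * k)) := by
  have hk0 : 0 < k := by linarith
  rw [Real.exp_le_exp, neg_le_neg_iff]
  refine (cap_exponent_bound hd hk).trans ?_
  have h1 : k ^ d * ((1 / 16) ^ (d + 1) * (1 / 2) ^ d) = (k / 512) ^ d * (16 ^ d / 16) := by
    rw [pow_succ (1 / 16 : ℝ) d, ← mul_assoc, ← mul_assoc, ← mul_pow, mul_right_comm _ (1 / 16 : ℝ), ← mul_pow,
      show k * (1 / 16) * (1 / 2) = k / 512 * 16 by ring, mul_pow]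
    ring
  rw [h1]
  refine le_mul_of_one_le_right (by positivity) ?_
  rw [le_div_iff₀ (by norm_num), one_mul]
  exact le_self_pow₀ (by norm_num) (by omega)

end Constants

end RandomPolytope

/-- The probability bound is stated for the complementary event. The range `c₂⁻¹ ^ (n - 1) ≤ m` of
the intensity is the one in which the lower bound `c₂ * m ^ (1 / (n - 1))` is at least `1`. -/
theorem mainTheorem3 :
    ∃ c₂ c₃ : ℝ, 0 < c₂ ∧ c₂ < 1 ∧ 1 < c₃ ∧
      ∀ (n : ℕ), 3 ≤ n → ∀ (m : ℝ≥0), c₂⁻¹ ^ (n - 1) ≤ (m : ℝ) →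
      ∀ {Ω : Type*} [MeasurableSpace Ω] (μ : Measure Ω) [IsProbabilityMeasure μ]
        (M : Ω → ℕ) (a : ℕ → Ω → RandomPolytope.UnitSphere n),
        RandomPolytope.IsPoissonSample μ n m M a →
        μ {ω | ((RandomPolytope.combDiam
                  (RandomPolytope.hullOfFirst (M ω) (fun i => a i ω)) : ℕ∞) : ℝ≥0∞) <
                ENNReal.ofReal (c₂ * (m : ℝ) ^ (1 / ((n : ℝ) - 1)))} ≤
          ENNReal.ofReal (Real.exp (-(c₃ ^ (n - 1) * (m : ℝ) ^ (1 / ((n : ℝ) - 1))))) := by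
  -- With `c₂ = 2⁻³⁵` the assumption on `m` becomes `k ≥ 2 ^ 35`, so `ε = 2 ^ 29 / k` is at most `1
  -- / 64`.
  refine ⟨(2 ^ 35)⁻¹, 2, by norm_num, by norm_num, by norm_num, ?_⟩
  intro n hn m hm Ω _ μ _ M a h
  obtain ⟨d, rfl⟩ : ∃ d, n = d + 1 := ⟨n - 1, by omega⟩
  have hd : 2 ≤ d := by omega
  have hexp : ((d + 1 : ℕ) : ℝ) - 1 = d := by push_cast; ring
  rw [hexp, Nat.add_sub_cancel]
  rw [Nat.add_sub_cancel, inv_inv] at hm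
  set k : ℝ := (m : ℝ) ^ (1 / (d : ℝ)) with hk
  have hkm : k ^ d = m := by
    rw [hk, one_div]
    exact Real.rpow_inv_natCast_pow m.coe_nonneg (by omega)
  have hk35 : 2 ^ 35 ≤ k := by
    refine le_of_pow_le_pow_left₀ (by omega : d ≠ 0) (by positivity) ?_
    rwa [hkm]
  have hk0 : 0 < k := by linarith
  have hε' : 512 * 2 ^ 20 / k ≤ 1 / 4 := by
    rw [div_le_div_iff₀ hk0 (by norm_num)]
    linarith
  have hL0 : 0 < 1 / (16 * (512 * 2 ^ 20 / k)) := by positivity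
  have hmain := h.measure_combDiam_lt_le (by omega) (by positivity) hε'
    (Nat.ceil_pos.2 hL0).ne' (Nat.ceil_lt_add_one hL0.le) ((2 ^ 35)⁻¹ * k)
  rw [Nat.add_sub_cancel, ← hkm] at hmain
  refine hmain.trans ((add_le_add (ENNReal.ofReal_le_ofReal (RandomPolytope.net_term_le hd hk35
    (Nat.le_ceil _) (Nat.ceil_lt_add_one hL0.le))) (add_le_add (ENNReal.ofReal_le_ofReal
    (RandomPolytope.cap_term_le hd hk35)) (ENNReal.ofReal_le_ofReal
    (RandomPolytope.cap_term_le hd hk35)))).trans ?_)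
  rw [← ENNReal.ofReal_add (by positivity) (by positivity),
    ← ENNReal.ofReal_add (by positivity) (by positivity)]
  refine ENNReal.ofReal_le_ofReal ?_
  -- Each of the three error terms is at most `exp (-(2 ^ (d + 1) * k))`, which is twice the
  -- required exponent. The spare factor `exp (2 ^ d * k) ≥ 3` absorbs their number.
  have h1 : 2 ≤ 2 ^ d * k := by
    have : (1 : ℝ) ≤ 2 ^ d := one_le_pow₀ (by norm_num)
    nlinarith
  have h2 : Real.exp (-(2 ^ d * k)) =
      Real.exp (-(2 ^ (d + 1) * k)) * Real.exp (2 ^ d * k) := by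
    rw [← Real.exp_add, pow_succ]
    ring_nf
  have h3 := Real.add_one_le_exp (2 ^ d * k)
  rw [h2]
  nlinarith [Real.exp_pos (-(2 ^ (d + 1) * k))]
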